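/- Let $\mathbb S$ be a finite set with at least two elements, and let $P=(P_{st})_{s,t\in\mathbb S}$ be a stochastic matrix that is reversible with respect to a probability distribution $\mu$ on $\mathbb S$ with $\mu_s>0$ for all $s$, that is, $\mu_sP_{st}=\mu_tP_{ts}$ for all $s,t$. Let $1=\lambda_0\ge\lambda_1\ge\dots\ge\lambda_{|\mathbb S|-1}$ be the (real) eigenvalues of $P$ counted with multiplicity, and suppose that the spectral gap $g=1-\lambda_1$ is positive. Let $f$ be a function on $\mathbb S$ with values in an $m$-dimensional real Euclidean space with norm $|\cdot|$, and suppose that $\sum_{s}\mu_sf(s)=0$ and $|f(s)|\le L$ for all $s$, where $L>0$. Let $s_0,s_1,s_2,\dots$ be a Markov chain with transition matrix $P$ whose initial state $s_0$ has distribution $\mu^{(0)}$, and put $S_N=\sum_{t=1}^Nf(s_t)$ and $$\|\mu^{(0)}/\mu\|=\Bigl(\sum_{s\in\mathbb S}\mu_s\bigl(\mu^{(0)}_s/\mu_s\bigr)^2\Bigr)^{1/2}.$$ Then for every $\varepsilon>0$ and every $N$, $$\Pr\{|S_N|\ge\varepsilon N\}\le 3\,\|\mu^{(0)}/\mu\|\,2^{m/2}\exp\Bigl[-\alpha\,\frac{\varepsilon^2}{L^2}\,N\Bigr],\qquad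 \alpha=\Bigl(4+\frac8g+\frac{1536}{125}\,\frac{g}{\log^2(1+g/2)}\Bigr)^{-1}.$$ -/

import Mathlib

open MeasureTheory

/-- The eigenvalues `λ₀ ≥ λ₁ ≥ …` of a real matrix, counted with algebraic multiplicity and listed
in non-increasing order. (A stochastic matrix that is reversible with respect to a positive
distribution is similar to a real symmetric matrix, so all its eigenvalues are real and this list
has length `Fintype.card S`.) -/
noncomputable def eigenvalueList {S : Type*} [Fintype S] [DecidableEq S] (P : Matrix S S ℝ) :
    List ℝ :=
  P.charpoly.roots.sort (· ≥ ·)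

/-- The spectral gap `1 - λ₁`, where `λ₁` is the second largest eigenvalue (with multiplicity).
The default value `0` of `getD` is not used when there are at least two real eigenvalues. -/
noncomputable def spectralGap {S : Type*} [Fintype S] [DecidableEq S] (P : Matrix S S ℝ) : ℝ :=
  1 - (eigenvalueList P).getD 1 0

/-- Reversibility (detailed balance) of `P` with respect to `μ`. Summing over `s` shows that a
distribution `μ` with this property is invariant for a stochastic matrix `P`. -/
def IsReversible {S : Type*} (P : Matrix S S ℝ) (μ : S → ℝ) : Prop :=
  ∀ s t, μ s * P s t = μ t * P t s

/-- `X₀, X₁, X₂, …` is a Markov chain on the finite state space `S` with initial distribution `μ₀`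
(the law of `X₀`) and transition matrix `P`, on the probability space `(Ω, ℙ)`. -/
structure IsMarkovChain {S Ω : Type*} [MeasurableSpace Ω] (ℙ : Measure Ω) (X : ℕ → Ω → S)
    (μ₀ : S → ℝ) (P : Matrix S S ℝ) : Prop where
  measurableSet_fiber : ∀ n s, MeasurableSet (X n ⁻¹' {s})
  law : ∀ (n : ℕ) (x : ℕ → S),
    ℙ.real {ω | ∀ i ≤ n, X i ω = x i} = μ₀ (x 0) * ∏ i ∈ Finset.range n, P (x i) (x (i + 1))

/-- `‖μ₀/μ‖ = (E[(μ₀(s)/μ(s))²])^(1/2)`, the expectation being taken for `s` distributed as `μ`. -/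
noncomputable def ratioNorm {S : Type*} [Fintype S] (μ₀ μ : S → ℝ) : ℝ :=
  Real.sqrt (∑ s, μ s * (μ₀ s / μ s) ^ 2)

/-- The partial sum `S_N = f(X₁) + ⋯ + f(X_N)`. -/
def partialSum {S Ω E : Type*} [AddCommMonoid E] (f : S → E) (X : ℕ → Ω → S) (N : ℕ) (ω : Ω) : E :=
  ∑ t ∈ Finset.Icc 1 N, f (X t ω)

/-! For `θ` in `E` put `u = ⟨θ, f⟩` and `r = ‖θ‖ L`. By Feynman–Kac the Laplace transform of `S_N`
at `θ` pairs `μ₀` with `T ^ N` applied to `1`, where `T s t = P s t * exp (u t)` is self-adjoint for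
the weight `μ exp u`. The spectral gap gives a Poincaré inequality; since `u` has mean zero, the
tilt acts only to second order, and the norm of `T` is at most `exp (4 r² / g)`
(`sum_mul_le_exp_mul_of_poincare`). Cauchy–Schwarz bounds the transform by `‖μ₀/μ‖ e^r exp (4 r² N /
g)` (`sum_trajectories_mul_exp_le`).

Averaging over a Gaussian `θ` turns this into an exponential moment of `‖S_N‖²`, at the cost of the
factor `2^(m/2)` (`sum_mul_exp_sq_norm_le`), and Markov's inequality gives the tail. The resulting
rate `(2 + 32 / g)⁻¹` is at least `α` (`eight_mul_le_of_pos`). -/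

open scoped Matrix

/-! ### Spectral gap and Poincaré inequality -/

/-- If the second eigenvalue of a real symmetric matrix is below an eigenvalue `1`, with unit
eigenvector `q`, then it bounds the quadratic form on the orthogonal complement of `q`. -/
lemma inner_toEuclideanLin_le_of_second_eigenvalue {S : Type*} [Fintype S] [DecidableEq S]
    [Nontrivial S] {B : Matrix S S ℝ} (hB : B.IsHermitian) {q : EuclideanSpace ℝ S}
    (hq : ‖q‖ = 1) (hBq : Matrix.toEuclideanLin B q = q)
    (hlt : (eigenvalueList B).getD 1 0 < 1) (x : EuclideanSpace ℝ S) :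
    inner ℝ x (Matrix.toEuclideanLin B x) ≤
      inner ℝ q x ^ 2 + (eigenvalueList B).getD 1 0 * (‖x‖ ^ 2 - inner ℝ q x ^ 2) := by
  set b := hB.eigenvectorBasis
  set ev := hB.eigenvalues
  set l := (eigenvalueList B).getD 1 0 with hl
  have hroots : (eigenvalueList B : Multiset ℝ) = Multiset.map ev Finset.univ.val := by
    rw [eigenvalueList, Multiset.sort_eq, hB.roots_charpoly_eq_eigenvalues]
    rfl
  have hsorted : (eigenvalueList B).Pairwise (· ≥ ·) := Multiset.pairwise_sort _ _
  -- `i₀` is an index attaining the head of the sorted list; erasing it leaves the tail, whose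
  -- largest entry is `l`.
  obtain ⟨i₀, hi₀⟩ : ∃ i₀, ∀ i, i ≠ i₀ → ev i ≤ l := by
    have hlen : (eigenvalueList B).length = Fintype.card S := by
      have := congrArg Multiset.card hroots
      simpa using this
    have hcard := Fintype.one_lt_card (α := S)
    match h : eigenvalueList B with
    | [] => simp [h] at hlen; omega
    | [a] => simp [h] at hlen; omega
    | a :: c :: t =>
      rw [h] at hroots hsorted
      have hlc : l = c := by simp [hl, h]
      have ha : a ∈ Multiset.map ev Finset.univ.val := by
        rw [← hroots]; simp
      obtain ⟨i₀, -, hi₀⟩ := Multiset.mem_map.1 ha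
      refine ⟨i₀, fun i hi ↦ ?_⟩
      have h1 : (Finset.univ : Finset S).val = i₀ ::ₘ (Finset.univ.erase i₀).val := by
        rw [Finset.erase_val, Multiset.cons_erase (Finset.mem_univ_val i₀)]
      rw [h1, Multiset.map_cons, hi₀, ← Multiset.cons_coe, Multiset.cons_inj_right] at hroots
      have h2 : ev i ∈ ((c :: t : List ℝ) : Multiset ℝ) := by
        rw [hroots]
        exact Multiset.mem_map_of_mem _ (Finset.mem_erase.2 ⟨hi, Finset.mem_univ i⟩)
      rw [hlc]
      rcases List.mem_cons.1 (Multiset.mem_coe.1 h2) with h3 | h3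
      · exact h3.le
      · exact (List.pairwise_cons.1 (List.pairwise_cons.1 hsorted).2).1 _ h3
  have hsymm := Matrix.isSymmetric_toEuclideanLin_iff.2 hB
  have hbi : ∀ i, Matrix.toEuclideanLin B (b i) = ev i • b i := by
    intro i
    have := hB.mulVec_eigenvectorBasis i
    ext s
    simpa [Matrix.toLpLin_apply] using congrFun this s
  have hBy : ∀ i y, inner ℝ (b i) (Matrix.toEuclideanLin B y) = ev i * inner ℝ (b i) y := by
    intro i y
    rw [← hsymm, hbi, real_inner_smul_left]
  -- Here `ev i ≤ l < 1`, so `b i` and `q` belong to different eigenvalues. Hence `q` is `± b i₀`.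
  have hqi : ∀ i, i ≠ i₀ → inner ℝ (b i) q = 0 := by
    intro i hi
    have h1 := hBy i q
    rw [hBq] at h1
    have h2 := hi₀ i hi
    have : (1 - ev i) * inner ℝ (b i) q = 0 := by linarith
    exact (mul_eq_zero.1 this).resolve_left (by linarith)
  have hexp : ∀ y z : EuclideanSpace ℝ S,
      inner ℝ y z = ∑ i, inner ℝ (b i) y * inner ℝ (b i) z := by
    intro y z
    rw [← b.sum_inner_mul_inner y z]
    simp only [real_inner_comm]
  have hq0 : inner ℝ (b i₀) q ^ 2 = 1 := by
    have h1 := hexp q q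
    rw [real_inner_self_eq_norm_sq, hq, Finset.sum_eq_single i₀
      (fun i _ hi ↦ by rw [hqi i hi, zero_mul]) (by simp)] at h1
    linarith
  have hev0 : ev i₀ = 1 := by
    have h1 := hBy i₀ q
    rw [hBq] at h1
    have h2 : inner ℝ (b i₀) q ≠ 0 := by
      intro h
      rw [h] at hq0
      norm_num at hq0
    exact (mul_right_cancel₀ h2 (by rw [one_mul]; exact h1)).symm
  have hqx : inner ℝ q x ^ 2 = inner ℝ (b i₀) x ^ 2 := by
    rw [hexp q x, Finset.sum_eq_single i₀
      (fun i _ hi ↦ by rw [hqi i hi, zero_mul]) (by simp), mul_pow, hq0, one_mul]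
  have hxx : ‖x‖ ^ 2 - inner ℝ q x ^ 2 = ∑ i ∈ Finset.univ.erase i₀, inner ℝ (b i) x ^ 2 := by
    rw [hqx, ← real_inner_self_eq_norm_sq, hexp x x,
      ← Finset.add_sum_erase _ _ (Finset.mem_univ i₀), ← pow_two, add_sub_cancel_left]
    simp only [pow_two]
  rw [hxx, hexp x, ← Finset.add_sum_erase _ _ (Finset.mem_univ i₀), hqx, hBy, hev0, one_mul,
    ← pow_two, Finset.mul_sum]
  refine add_le_add_right (Finset.sum_le_sum fun i hi ↦ ?_) _
  rw [hBy]
  have := mul_le_mul_of_nonneg_right (hi₀ i (Finset.ne_of_mem_erase hi))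
    (sq_nonneg (inner ℝ (b i) x))
  linarith

lemma charpoly_diagonal_conj {S : Type*} [Fintype S] [DecidableEq S] (P : Matrix S S ℝ)
    {d : S → ℝ} (hd : ∀ s, d s ≠ 0) :
    (Matrix.of fun s t ↦ d s * P s t / d t).charpoly = P.charpoly := by
  let M : (Matrix S S ℝ)ˣ :=
    ⟨Matrix.diagonal d, Matrix.diagonal fun s ↦ (d s)⁻¹,
      by simp [Matrix.diagonal_mul_diagonal, hd], by simp [Matrix.diagonal_mul_diagonal, hd]⟩
  rw [← Matrix.charpoly_units_conj M P]
  congr 1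
  ext s t
  rw [← Matrix.coe_units_inv]
  change _ = (Matrix.diagonal d * P * Matrix.diagonal fun s ↦ (d s)⁻¹) s t
  simp [Matrix.diagonal_mul, Matrix.mul_diagonal, div_eq_mul_inv]

/-- The Poincaré inequality of a reversible chain: the Dirichlet form dominates the spectral gap
times the variance. -/
lemma sum_mul_le_of_spectralGap_pos {S : Type*} [Fintype S] [DecidableEq S] [Nontrivial S]
    {P : Matrix S S ℝ} (hP : P ∈ Matrix.rowStochastic ℝ S) {μ : S → ℝ} (hμ : ∑ s, μ s = 1)
    (hμ_pos : ∀ s, 0 < μ s) (hrev : IsReversible P μ) (hg : 0 < spectralGap P) (w : S → ℝ) :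
    ∑ s, ∑ t, μ s * P s t * (w s * w t) ≤
      (1 - spectralGap P) * ∑ s, μ s * w s ^ 2 + spectralGap P * (∑ s, μ s * w s) ^ 2 := by
  set d : S → ℝ := fun s ↦ √(μ s) with hd
  have hdpos : ∀ s, 0 < d s := fun s ↦ Real.sqrt_pos.2 (hμ_pos s)
  have hdne : ∀ s, d s ≠ 0 := fun s ↦ (hdpos s).ne'
  have hdsq : ∀ s, μ s = d s * d s := fun s ↦ (Real.mul_self_sqrt (hμ_pos s).le).symm
  -- Conjugation by `√μ` turns detailed balance into symmetry and keeps the eigenvalues; the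
  -- constant function `1` becomes the unit eigenvector `√μ`.
  set B : Matrix S S ℝ := Matrix.of fun s t ↦ d s * P s t / d t with hBdef
  have hBher : B.IsHermitian := by
    ext s t
    have h := hrev s t
    rw [hdsq, hdsq t] at h
    simp only [Matrix.conjTranspose_apply, hBdef, Matrix.of_apply, star_trivial]
    rw [div_eq_div_iff (hdne _) (hdne _)]
    linarith
  have hlist : eigenvalueList B = eigenvalueList P := by
    rw [eigenvalueList, charpoly_diagonal_conj P hdne, eigenvalueList]
  set q : EuclideanSpace ℝ S := WithLp.toLp 2 d
  have hq : ‖q‖ = 1 := by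
    rw [EuclideanSpace.norm_eq, Real.sqrt_eq_one, ← hμ]
    exact Finset.sum_congr rfl fun s _ ↦ by
      rw [hdsq s, Real.norm_eq_abs, sq_abs, pow_two]
  have hBq : Matrix.toEuclideanLin B q = q := by
    ext s
    simp only [Matrix.toLpLin_apply, Matrix.mulVec, dotProduct, q, hBdef, Matrix.of_apply]
    rw [Finset.sum_congr rfl fun t _ ↦ div_mul_cancel₀ (d s * P s t) (hdne t), ← Finset.mul_sum,
      Matrix.sum_row_of_mem_rowStochastic hP, mul_one]
  have key := inner_toEuclideanLin_le_of_second_eigenvalue hBher hq hBq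
    (by rw [hlist]; unfold spectralGap at hg; linarith) (WithLp.toLp 2 fun s ↦ d s * w s)
  rw [hlist] at key
  have h1 : inner ℝ q (WithLp.toLp 2 fun s ↦ d s * w s) = ∑ s, μ s * w s := by
    simp only [PiLp.inner_apply, q, RCLike.inner_apply, conj_trivial]
    exact Finset.sum_congr rfl fun s _ ↦ by rw [hdsq s]; ring
  have h2 : ‖(WithLp.toLp 2 fun s ↦ d s * w s : EuclideanSpace ℝ S)‖ ^ 2 =
      ∑ s, μ s * w s ^ 2 := by
    rw [EuclideanSpace.norm_sq_eq]
    exact Finset.sum_congr rfl fun s _ ↦ by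
      rw [hdsq s, Real.norm_eq_abs, sq_abs]; ring
  have h3 : inner ℝ (WithLp.toLp 2 fun s ↦ d s * w s : EuclideanSpace ℝ S)
      (Matrix.toEuclideanLin B (WithLp.toLp 2 fun s ↦ d s * w s)) =
      ∑ s, ∑ t, μ s * P s t * (w s * w t) := by
    simp only [PiLp.inner_apply, RCLike.inner_apply, conj_trivial, Matrix.toLpLin_apply,
      Matrix.mulVec, dotProduct, hBdef, Matrix.of_apply, Finset.sum_mul]
    refine Finset.sum_congr rfl fun s _ ↦ Finset.sum_congr rfl fun t _ ↦ ?_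
    rw [hdsq s]
    have := hdne t
    field_simp
  rw [h1, h2, h3] at key
  unfold spectralGap
  linarith

/-- A spectral gap constant of a reversible chain is at most `2`. -/
lemma le_two_of_poincare {S : Type*} [Fintype S] [DecidableEq S] [Nontrivial S]
    {P : Matrix S S ℝ} (hP : P ∈ Matrix.rowStochastic ℝ S) {μ : S → ℝ}
    (hμ_pos : ∀ s, 0 < μ s) (hrev : IsReversible P μ) {g : ℝ}
    (hgap : ∀ w : S → ℝ, ∑ s, ∑ t, μ s * P s t * (w s * w t) ≤
      (1 - g) * ∑ s, μ s * w s ^ 2 + g * (∑ s, μ s * w s) ^ 2) : g ≤ 2 := by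
  obtain ⟨a, b, hab⟩ := exists_pair_ne S
  -- A nonzero function of mean zero. Expanding `∑ μ P (w s + w t)² ≥ 0` bounds its form below by
  -- minus its variance, while `hgap` bounds it above by `1 - g` times the variance.
  set w : S → ℝ := fun s ↦ ((if s = a then 1 else 0) - if s = b then 1 else 0) / μ s with hw
  have hmean : ∑ s, μ s * w s = 0 := by
    have : ∀ s, μ s * w s = (if s = a then 1 else 0) - if s = b then 1 else 0 := fun s ↦
      mul_div_cancel₀ _ (hμ_pos s).ne'
    simp [this]
  have hpos : 0 < ∑ s, μ s * w s ^ 2 := by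
    refine Finset.sum_pos' (fun s _ ↦ mul_nonneg (hμ_pos s).le (sq_nonneg _))
      ⟨a, Finset.mem_univ a, mul_pos (hμ_pos a) (sq_pos_of_pos ?_)⟩
    simp [hw, hab, hμ_pos a]
  have hform : 0 ≤ ∑ s, ∑ t, μ s * P s t * (w s + w t) ^ 2 :=
    Finset.sum_nonneg fun s _ ↦ Finset.sum_nonneg fun t _ ↦
      mul_nonneg (mul_nonneg (hμ_pos s).le (Matrix.nonneg_of_mem_rowStochastic hP)) (sq_nonneg _)
  have h1 : ∑ s, ∑ t, μ s * P s t * w s ^ 2 = ∑ s, μ s * w s ^ 2 := by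
    refine Finset.sum_congr rfl fun s _ ↦ ?_
    rw [← Finset.sum_mul, ← Finset.mul_sum, Matrix.sum_row_of_mem_rowStochastic hP, mul_one]
  have h2 : ∑ s, ∑ t, μ s * P s t * w t ^ 2 = ∑ s, μ s * w s ^ 2 := by
    rw [Finset.sum_comm, ← h1]
    exact Finset.sum_congr rfl fun s _ ↦ Finset.sum_congr rfl fun t _ ↦ by rw [hrev t s]
  have h3 : ∑ s, ∑ t, μ s * P s t * (w s + w t) ^ 2 =
      ∑ s, ∑ t, μ s * P s t * w s ^ 2 + ∑ s, ∑ t, μ s * P s t * w t ^ 2 +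
        2 * ∑ s, ∑ t, μ s * P s t * (w s * w t) := by
    simp only [Finset.mul_sum, ← Finset.sum_add_distrib]
    exact Finset.sum_congr rfl fun s _ ↦ Finset.sum_congr rfl fun t _ ↦ by ring
  have h4 := hgap w
  rw [hmean] at h4
  rw [h3, h1, h2] at hform
  have h5 : 0 ≤ (2 - g) * ∑ s, μ s * w s ^ 2 := by nlinarith
  have := nonneg_of_mul_nonneg_left h5 hpos
  linarith

/-! ### The tilted quadratic form -/

/-- The cross term is absorbed by AM–GM: `q ≤ 1/2` gives `((1 + q) r)² ≤ (9/4) r² = q * (9/16) g`,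
and the remaining `H²` coefficient is nonnegative because `r < g/4` leaves `g - r - (9/16) g > 0`.
-/
lemma quadratic_le_of_small_tilt {g r q A : ℝ} (hg : 0 < g) (hg2 : g ≤ 2) (hr : 0 ≤ r)
    (hrg : r < g / 4) (hgq : g * q = 4 * r ^ 2) (H : ℝ) :
    A ^ 2 + (1 - g) * H ^ 2 ≤ (1 + q) * (A ^ 2 - 2 * A * (r * H) + (1 - r) * H ^ 2) := by
  have hq0 : 0 ≤ q := nonneg_of_mul_nonneg_right (by rw [hgq]; positivity) hg
  have hq1 : q ≤ 1 / 2 := by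
    by_contra! h
    nlinarith
  have h1 : 2 * A * ((1 + q) * r * H) ≤ q * A ^ 2 + 9 / 16 * g * H ^ 2 := by
    rcases hr.eq_or_lt with h0 | h0
    · rw [← h0]
      ring_nf
      positivity
    · have hqpos : 0 < q := pos_of_mul_pos_right (by rw [hgq]; positivity) hg.le
      have h2 : ((1 + q) * r * H) ^ 2 ≤ q * (9 / 16 * g * H ^ 2) := by
        have : q * (9 / 16 * g * H ^ 2) = 9 / 4 * r ^ 2 * H ^ 2 := by
          linear_combination 9 / 16 * H ^ 2 * hgq
        rw [this, mul_pow, mul_pow]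
        have h5 : (1 + q) ^ 2 ≤ 9 / 4 := by nlinarith
        gcongr
      have h3 : 0 ≤ (q * A - (1 + q) * r * H) ^ 2 := sq_nonneg _
      refine le_of_mul_le_mul_left ?_ hqpos
      linarith
  have h2 : 0 ≤ (g - r - 9 / 16 * g + q * (1 - r)) * H ^ 2 := by
    refine mul_nonneg ?_ (sq_nonneg _)
    have : 0 ≤ q * (1 - r) := mul_nonneg hq0 (by linarith)
    linarith
  linarith

/-- Under a Poincaré inequality with constant `g`, a mean-zero tilt `u` of size at most `r`
increases the top of the quadratic form by a factor at most `exp (4 r² / g)`. -/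
lemma sum_mul_le_exp_mul_of_poincare {S : Type*} [Fintype S] {P : Matrix S S ℝ} {μ : S → ℝ}
    (hμ : ∑ s, μ s = 1) (hμ_pos : ∀ s, 0 ≤ μ s) {g : ℝ} (hg : 0 < g) (hg2 : g ≤ 2)
    (hgap : ∀ w : S → ℝ, ∑ s, ∑ t, μ s * P s t * (w s * w t) ≤
      (1 - g) * ∑ s, μ s * w s ^ 2 + g * (∑ s, μ s * w s) ^ 2)
    {u : S → ℝ} {r : ℝ} (hr : 0 ≤ r) (hu : ∀ s, |u s| ≤ r) (hmean : ∑ s, μ s * u s = 0)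
    (w : S → ℝ) :
    ∑ s, ∑ t, μ s * P s t * (w s * w t) ≤
      Real.exp (4 / g * r ^ 2) * ∑ s, μ s * Real.exp (-u s) * w s ^ 2 := by
  set a := ∑ s, μ s * w s with ha
  set V := ∑ s, μ s * (w s - a) ^ 2 with hV
  have hV0 : 0 ≤ V := Finset.sum_nonneg fun s _ ↦ mul_nonneg (hμ_pos s) (sq_nonneg _)
  have hsq : ∑ s, μ s * w s ^ 2 = a ^ 2 + V := by
    have : ∀ s, μ s * (w s - a) ^ 2 = μ s * w s ^ 2 - 2 * a * (μ s * w s) + a ^ 2 * μ s :=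
      fun s ↦ by ring
    simp only [hV, this, Finset.sum_add_distrib, Finset.sum_sub_distrib, ← Finset.mul_sum, hμ,
      ← ha]
    ring
  have hform := hgap w
  rw [hsq, ← ha] at hform
  have hform' : ∑ s, ∑ t, μ s * P s t * (w s * w t) ≤ a ^ 2 + (1 - g) * V := by linarith
  refine hform'.trans ?_
  -- For `r ≥ g/4` the crude bound `exp (-u) ≥ exp (-r)` suffices, since then `r ≤ 4 r² / g`. For
  -- smaller `r` the second-order expansion is needed.
  rcases le_or_gt (g / 4) r with hrg | hrg
  · have h1 : a ^ 2 + V ≤ Real.exp r * ∑ s, μ s * Real.exp (-u s) * w s ^ 2 := by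
      rw [← hsq, Finset.mul_sum]
      refine Finset.sum_le_sum fun s _ ↦ ?_
      have h2 : 1 ≤ Real.exp r * Real.exp (-u s) := by
        rw [← Real.exp_add]
        exact Real.one_le_exp (by linarith [(abs_le.1 (hu s)).2])
      nlinarith [mul_le_mul_of_nonneg_right h2 (mul_nonneg (hμ_pos s) (sq_nonneg (w s)))]
    have h2 : r ≤ 4 / g * r ^ 2 := by
      rw [div_mul_eq_mul_div, le_div_iff₀ hg]
      nlinarith
    calc a ^ 2 + (1 - g) * V ≤ a ^ 2 + V := by nlinarith
      _ ≤ _ := h1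
      _ ≤ _ := by
        gcongr
        exact Finset.sum_nonneg fun s _ ↦
          mul_nonneg (mul_nonneg (hμ_pos s) (Real.exp_pos _).le) (sq_nonneg _)
  · set H := √V with hH
    have hHV : H ^ 2 = V := Real.sq_sqrt hV0
    have hH0 : 0 ≤ H := Real.sqrt_nonneg _
    set c := ∑ s, μ s * u s * (w s - a) with hc
    have hcabs : |c| ≤ r * H := by
      have hcs : c ^ 2 ≤ (∑ s, μ s * u s ^ 2) * V := by
        refine Finset.sum_sq_le_sum_mul_sum_of_sq_le_mul _
          (fun s _ ↦ mul_nonneg (hμ_pos s) (sq_nonneg _))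
          (fun s _ ↦ mul_nonneg (hμ_pos s) (sq_nonneg _)) fun s _ ↦ le_of_eq (by ring)
      have hu2 : ∑ s, μ s * u s ^ 2 ≤ r ^ 2 := by
        calc ∑ s, μ s * u s ^ 2 ≤ ∑ s, μ s * r ^ 2 := by
              exact Finset.sum_le_sum fun s _ ↦ mul_le_mul_of_nonneg_left
                (sq_le_sq.2 (by rw [abs_of_nonneg hr]; exact hu s)) (hμ_pos s)
          _ = r ^ 2 := by rw [← Finset.sum_mul, hμ, one_mul]
      refine abs_le_of_sq_le_sq (hcs.trans ?_) (by positivity)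
      rw [mul_pow, hHV]
      gcongr
    -- Use `exp (-u) ≥ 1 - u` and split `w = a + (w - a)`: the term `a² ∑ μ u` vanishes, so `u`
    -- enters only through the cross term `c` and the variance.
    have hlow : a ^ 2 - 2 * |a| * (r * H) + (1 - r) * V ≤
        ∑ s, μ s * Real.exp (-u s) * w s ^ 2 := by
      have h1 : ∑ s, μ s * (1 - u s) * w s ^ 2 ≤ ∑ s, μ s * Real.exp (-u s) * w s ^ 2 := by
        gcongr with s
        · exact hμ_pos s
        · linarith [Real.add_one_le_exp (-u s)]
      have h2 : ∑ s, μ s * (1 - u s) * w s ^ 2 =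
          a ^ 2 + V - 2 * a * c - ∑ s, μ s * u s * (w s - a) ^ 2 := by
        have h3 : ∀ s, μ s * (1 - u s) * w s ^ 2 = μ s * w s ^ 2 - a ^ 2 * (μ s * u s) -
            2 * a * (μ s * u s * (w s - a)) - μ s * u s * (w s - a) ^ 2 := fun s ↦ by ring
        simp only [h3, Finset.sum_sub_distrib, ← Finset.mul_sum, hmean, hsq, ← hc]
        ring
      have h3 : ∑ s, μ s * u s * (w s - a) ^ 2 ≤ r * V := by
        rw [hV, Finset.mul_sum]
        refine Finset.sum_le_sum fun s _ ↦ ?_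
        nlinarith [mul_le_mul_of_nonneg_right (abs_le.1 (hu s)).2
          (mul_nonneg (hμ_pos s) (sq_nonneg (w s - a)))]
      have h4 : a * c ≤ |a| * (r * H) := by
        calc a * c ≤ |a * c| := le_abs_self _
          _ = |a| * |c| := abs_mul _ _
          _ ≤ _ := by gcongr
      linarith
    set q := 4 / g * r ^ 2 with hq
    have hA2 : |a| ^ 2 = a ^ 2 := sq_abs a
    have hquad := quadratic_le_of_small_tilt (A := |a|) hg hg2 hr hrg
      (show g * q = 4 * r ^ 2 by rw [hq]; field_simp) H
    set A := |a|
    have hr2 : r ≤ 1 / 2 := by linarith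
    rw [hA2, hHV] at hquad
    have hnn : 0 ≤ a ^ 2 - 2 * A * (r * H) + (1 - r) * V := by
      rw [← hA2, ← hHV]
      nlinarith [sq_nonneg (A - r * H), mul_nonneg (show 0 ≤ 1 - r - r ^ 2 by nlinarith)
        (sq_nonneg H)]
    calc a ^ 2 + (1 - g) * V ≤ _ := hquad
      _ ≤ Real.exp q * (a ^ 2 - 2 * A * (r * H) + (1 - r) * V) := by
        gcongr
        linarith [Real.add_one_le_exp q]
      _ ≤ _ := by gcongr

/-! ### Norms of self-adjoint matrices and sums over trajectories -/

/-- A matrix that is symmetric for the weighted inner product `∑ w x y` and whose quadratic form is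
bounded by `Λ` is bounded by `Λ` in norm. -/
lemma sum_mul_mulVec_sq_le {S : Type*} [Fintype S] {w : S → ℝ}
    {T : Matrix S S ℝ} (hT : ∀ s t, w s * T s t = w t * T t s) {Λ : ℝ} (hΛ : 0 < Λ)
    (h : ∀ v : S → ℝ, |∑ s, w s * v s * (T *ᵥ v) s| ≤ Λ * ∑ s, w s * v s ^ 2) (v : S → ℝ) :
    ∑ s, w s * (T *ᵥ v) s ^ 2 ≤ Λ ^ 2 * ∑ s, w s * v s ^ 2 := by
  have hsymm : ∀ x y : S → ℝ,
      ∑ s, w s * x s * (T *ᵥ y) s = ∑ s, w s * y s * (T *ᵥ x) s := by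
    intro x y
    simp only [Matrix.mulVec, dotProduct, Finset.mul_sum]
    rw [Finset.sum_comm]
    refine Finset.sum_congr rfl fun s _ ↦ Finset.sum_congr rfl fun t _ ↦ ?_
    linear_combination x t * y s * hT t s
  -- Polarization at `v ± y`: with `X = ‖T v‖²` and `Y = ‖v‖²`, the parallelogram law gives `4 X / Λ
  -- ≤ Λ (2 Y + 2 X / Λ²)`, that is `X ≤ Λ² Y`.
  set y : S → ℝ := Λ⁻¹ • (T *ᵥ v) with hy
  have hplus := (abs_le.1 (h (v + y))).2
  have hminus := (abs_le.1 (h (v - y))).1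
  have hnorm : ∑ s, w s * (v + y) s ^ 2 + ∑ s, w s * (v - y) s ^ 2 =
      2 * ∑ s, w s * v s ^ 2 + 2 * ∑ s, w s * y s ^ 2 := by
    simp only [Finset.mul_sum, ← Finset.sum_add_distrib, Pi.add_apply, Pi.sub_apply]
    exact Finset.sum_congr rfl fun s _ ↦ by ring
  have hpol : ∑ s, w s * (v + y) s * (T *ᵥ (v + y)) s - ∑ s, w s * (v - y) s * (T *ᵥ (v - y)) s =
      4 * ∑ s, w s * y s * (T *ᵥ v) s := by
    have h1 : ∑ s, w s * (v + y) s * (T *ᵥ (v + y)) s -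
        ∑ s, w s * (v - y) s * (T *ᵥ (v - y)) s =
        2 * ∑ s, w s * y s * (T *ᵥ v) s + 2 * ∑ s, w s * v s * (T *ᵥ y) s := by
      simp only [Finset.mul_sum, ← Finset.sum_add_distrib, ← Finset.sum_sub_distrib,
        Matrix.mulVec_add, Matrix.mulVec_sub, Pi.add_apply, Pi.sub_apply]
      exact Finset.sum_congr rfl fun s _ ↦ by ring
    rw [h1, hsymm v y]
    ring
  have hyT : ∑ s, w s * y s * (T *ᵥ v) s = Λ⁻¹ * ∑ s, w s * (T *ᵥ v) s ^ 2 := by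
    rw [Finset.mul_sum]
    exact Finset.sum_congr rfl fun s _ ↦ by simp only [hy, Pi.smul_apply, smul_eq_mul]; ring
  have hyy : ∑ s, w s * y s ^ 2 = Λ⁻¹ ^ 2 * ∑ s, w s * (T *ᵥ v) s ^ 2 := by
    rw [Finset.mul_sum]
    exact Finset.sum_congr rfl fun s _ ↦ by simp only [hy, Pi.smul_apply, smul_eq_mul]; ring
  rw [hyT] at hpol
  rw [hyy] at hnorm
  set X := ∑ s, w s * (T *ᵥ v) s ^ 2
  set Y := ∑ s, w s * v s ^ 2
  have hle : 4 * (Λ⁻¹ * X) ≤ Λ * (2 * Y + 2 * (Λ⁻¹ ^ 2 * X)) := by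
    rw [← hnorm, mul_add]
    linarith
  have hmul := mul_le_mul_of_nonneg_left hle hΛ.le
  have e1 : Λ * (4 * (Λ⁻¹ * X)) = 4 * X := by field_simp
  have e2 : Λ * (Λ * (2 * Y + 2 * (Λ⁻¹ ^ 2 * X))) = 2 * (Λ ^ 2 * Y) + 2 * X := by field_simp
  linarith

lemma sum_mul_pow_mulVec_sq_le {S : Type*} [Fintype S] [DecidableEq S] {w : S → ℝ}
    {T : Matrix S S ℝ} {Λ : ℝ}
    (h : ∀ v : S → ℝ, ∑ s, w s * (T *ᵥ v) s ^ 2 ≤ Λ ^ 2 * ∑ s, w s * v s ^ 2) (v : S → ℝ)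
    (n : ℕ) :
    ∑ s, w s * ((T ^ n) *ᵥ v) s ^ 2 ≤ (Λ ^ n) ^ 2 * ∑ s, w s * v s ^ 2 := by
  induction n with
  | zero => simp
  | succ n ih =>
    rw [pow_succ' T, ← Matrix.mulVec_mulVec]
    calc _ ≤ _ := h _
      _ ≤ Λ ^ 2 * ((Λ ^ n) ^ 2 * ∑ s, w s * v s ^ 2) := by gcongr
      _ = _ := by ring

/-- Feynman–Kac representation: sums of multiplicative functionals over trajectories are powers of
the tilted transition matrix. -/
lemma sum_trajectories_eq_pow_mulVec {S : Type*} [Fintype S] [DecidableEq S] (T : Matrix S S ℝ)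
    (n : ℕ) (φ : S → ℝ) :
    ∑ x : Fin (n + 1) → S, φ (x 0) * ∏ i : Fin n, T (x i.castSucc) (x i.succ) =
      ∑ s, φ s * ((T ^ n) *ᵥ 1) s := by
  induction n generalizing φ with
  | zero =>
    rw [← (Equiv.funUnique (Fin 1) S).symm.sum_comp]
    simp
  | succ n ih =>
    rw [← (Fin.consEquiv fun _ ↦ S).sum_comp, Fintype.sum_prod_type]
    refine Finset.sum_congr rfl fun s _ ↦ ?_
    -- The first transition out of `s` is absorbed into the initial weight.
    have h := ih fun t ↦ φ s * T s t
    rw [pow_succ' T, ← Matrix.mulVec_mulVec, Matrix.mulVec, dotProduct, Finset.mul_sum]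
    simp only [mul_assoc] at h
    rw [← h]
    refine Finset.sum_congr rfl fun x _ ↦ ?_
    rw [Fin.prod_univ_succ]
    simp [Fin.consEquiv]

/-! ### Gaussian averaging -/

lemma integral_exp_neg_mul_sq_norm_add_inner {E : Type*} [NormedAddCommGroup E]
    [InnerProductSpace ℝ E] [FiniteDimensional ℝ E] [MeasurableSpace E] [BorelSpace E]
    {b : ℝ} (hb : 0 < b) (z : E) :
    ∫ v : E, Real.exp (-b * ‖v‖ ^ 2 + inner ℝ v z) =
      (Real.pi / b) ^ (Module.finrank ℝ E / 2 : ℝ) * Real.exp (‖z‖ ^ 2 / (4 * b)) := by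
  have h1 : ∀ v : E, Real.exp (-b * ‖v‖ ^ 2 + inner ℝ v z) =
      Real.exp (-b * ‖v - (1 / (2 * b)) • z‖ ^ 2) * Real.exp (‖z‖ ^ 2 / (4 * b)) := by
    intro v
    rw [← Real.exp_add, norm_sub_sq_real, norm_smul, real_inner_smul_right, mul_pow,
      Real.norm_eq_abs, sq_abs]
    congr 1
    field_simp
    ring
  simp only [h1]
  rw [integral_mul_const, integral_sub_right_eq_self (fun v : E ↦ Real.exp (-b * ‖v‖ ^ 2)),
    GaussianFourier.integral_rexp_neg_mul_sq_norm hb]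

/-- Gaussian averaging: a sub-Gaussian bound on the Laplace transform in every direction bounds an
exponential moment of the squared norm. -/
lemma sum_mul_exp_sq_norm_le {E : Type*} [NormedAddCommGroup E]
    [InnerProductSpace ℝ E] [FiniteDimensional ℝ E] {ι : Type*} [Fintype ι] (p : ι → ℝ)
    (z : ι → E) {C a : ℝ} (ha : 0 < a)
    (h : ∀ θ : E, ∑ i, p i * Real.exp (inner ℝ θ (z i)) ≤ C * Real.exp (a * ‖θ‖ ^ 2)) :
    ∑ i, p i * Real.exp (‖z i‖ ^ 2 / (8 * a)) ≤
      C * (2 : ℝ) ^ ((Module.finrank ℝ E : ℝ) / 2) := by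
  let _ : MeasurableSpace E := borel E
  have : BorelSpace E := ⟨rfl⟩
  have hint : ∀ {b : ℝ}, 0 < b → ∀ z : E,
      Integrable fun v : E ↦ Real.exp (-b * ‖v‖ ^ 2 + inner ℝ v z) := by
    intro b hb z
    -- A non-integrable function has Bochner integral `0`, but the closed formula is positive.
    by_contra hni
    have h1 := integral_exp_neg_mul_sq_norm_add_inner hb z
    rw [integral_undef hni] at h1
    have := Real.pi_pos
    have h2 : 0 < (Real.pi / b) ^ (Module.finrank ℝ E / 2 : ℝ) *
      Real.exp (‖z‖ ^ 2 / (4 * b)) := by positivity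
    exact h2.ne h1
  -- The weight `exp (-2a ‖θ‖²)` beats the growth `exp (a ‖θ‖²)` and leaves `exp (-a ‖θ‖²)`; the
  -- ratio of the two Gaussian normalisations is `2^(m/2)`.
  have hle : ∫ θ : E, ∑ i, p i * Real.exp (-(2 * a) * ‖θ‖ ^ 2 + inner ℝ θ (z i)) ≤
      ∫ θ : E, C * Real.exp (-a * ‖θ‖ ^ 2 + inner ℝ θ (0 : E)) := by
    refine integral_mono (integrable_finsetSum _ fun i _ ↦
      (hint (by positivity) (z i)).const_mul (p i)) ((hint ha 0).const_mul C) fun θ ↦ ?_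
    have h1 := mul_le_mul_of_nonneg_left (h θ) (Real.exp_pos (-(2 * a) * ‖θ‖ ^ 2)).le
    rw [Finset.mul_sum] at h1
    calc ∑ i, p i * Real.exp (-(2 * a) * ‖θ‖ ^ 2 + inner ℝ θ (z i)) = _ :=
          Finset.sum_congr rfl fun i _ ↦ by rw [Real.exp_add]; ring
      _ ≤ _ := h1
      _ = _ := by
        rw [mul_left_comm, ← Real.exp_add, inner_zero_right]
        ring_nf
  rw [integral_finsetSum _ fun i _ ↦ (hint (by positivity) (z i)).const_mul (p i)] at hle
  simp only [integral_const_mul] at hle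
  simp only [integral_exp_neg_mul_sq_norm_add_inner ha,
    integral_exp_neg_mul_sq_norm_add_inner (show 0 < 2 * a by positivity), norm_zero] at hle
  have hpi := Real.pi_pos
  have hsplit : (Real.pi / a) ^ (Module.finrank ℝ E / 2 : ℝ) =
      (2 : ℝ) ^ ((Module.finrank ℝ E : ℝ) / 2) *
        (Real.pi / (2 * a)) ^ (Module.finrank ℝ E / 2 : ℝ) := by
    rw [← Real.mul_rpow (by norm_num) (by positivity)]
    congr 1
    field_simp
  rw [hsplit] at hle
  have hK : 0 < (Real.pi / (2 * a)) ^ (Module.finrank ℝ E / 2 : ℝ) := by positivity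
  refine le_of_mul_le_mul_left ?_ hK
  rw [Finset.mul_sum]
  calc _ = _ := Finset.sum_congr rfl fun i _ ↦ by
        rw [mul_left_comm, show 8 * a = 4 * (2 * a) by ring]
    _ ≤ _ := hle
    _ = _ := by simp; ring

/-! ### Trajectory probabilities and the initial distribution -/

/-- A Markov chain has the probability of any event about its first steps bounded by the total
weight of the corresponding trajectories. -/
lemma IsMarkovChain.measureReal_le {S Ω : Type*} [Fintype S] [MeasurableSpace Ω]
    {ℙ : Measure Ω} [IsProbabilityMeasure ℙ] {X : ℕ → Ω → S} {μ₀ : S → ℝ} {P : Matrix S S ℝ}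
    (hX : IsMarkovChain ℙ X μ₀ P) (N : ℕ) (A : Finset (Fin (N + 1) → S)) :
    ℙ.real {ω | (fun i : Fin (N + 1) ↦ X i ω) ∈ A} ≤
      ∑ x ∈ A, μ₀ (x 0) * ∏ i : Fin N, P (x i.castSucc) (x i.succ) := by
  -- `Fin.ofNat` extends a finite trajectory periodically to `ℕ`; only the indices `≤ N` matter.
  have hsub : {ω | (fun i : Fin (N + 1) ↦ X i ω) ∈ A} ⊆
      ⋃ x ∈ A, {ω | ∀ i ≤ N, X i ω = x (Fin.ofNat (N + 1) i)} := by
    intro ω hω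
    refine Set.mem_iUnion₂.2 ⟨_, hω, fun i hi ↦ ?_⟩
    simp [Nat.mod_eq_of_lt (Nat.lt_succ_of_le hi)]
  refine (measureReal_mono hsub (measure_ne_top _ _)).trans ((measureReal_biUnion_finset_le _ _).trans_eq ?_)
  refine Finset.sum_congr rfl fun x _ ↦ ?_
  rw [hX.law N fun i ↦ x (Fin.ofNat (N + 1) i), Finset.prod_range]
  congr 1
  refine Finset.prod_congr rfl fun i _ ↦ ?_
  congr 2
  · ext; simp
  · ext; simp [Nat.mod_eq_of_lt (Nat.succ_lt_succ i.2)]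

/-- Cauchy–Schwarz. This is what makes the final bound trivial for `N = 0`. -/
lemma one_le_ratioNorm {S : Type*} [Fintype S] {μ₀ μ : S → ℝ} (hμ₀ : ∑ s, μ₀ s = 1)
    (hμ : ∑ s, μ s = 1) (hμ_pos : ∀ s, 0 < μ s) : 1 ≤ ratioNorm μ₀ μ := by
  rw [ratioNorm, Real.one_le_sqrt]
  have h : (∑ s, μ₀ s) ^ 2 ≤ (∑ s, μ s) * ∑ s, μ s * (μ₀ s / μ s) ^ 2 := by
    refine Finset.sum_sq_le_sum_mul_sum_of_sq_le_mul _ (fun s _ ↦ (hμ_pos s).le)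
      (fun s _ ↦ mul_nonneg (hμ_pos s).le (sq_nonneg _)) fun s _ ↦ le_of_eq ?_
    have := (hμ_pos s).ne'
    field_simp
  rwa [hμ₀, hμ, one_mul, one_pow] at h

/-! ### Laplace transform of the additive functional -/

/-- The Laplace transform of the additive functional of a reversible chain satisfying a Poincaré
inequality with constant `g`. -/
lemma sum_trajectories_mul_exp_le {S : Type*} [Fintype S] [DecidableEq S]
    {P : Matrix S S ℝ} (hP : ∀ s t, 0 ≤ P s t) {μ : S → ℝ}
    (hμ : ∑ s, μ s = 1) (hμ_pos : ∀ s, 0 < μ s) (hrev : IsReversible P μ)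
    {g : ℝ} (hg : 0 < g) (hg2 : g ≤ 2)
    (hgap : ∀ w : S → ℝ, ∑ s, ∑ t, μ s * P s t * (w s * w t) ≤
      (1 - g) * ∑ s, μ s * w s ^ 2 + g * (∑ s, μ s * w s) ^ 2)
    (μ₀ : S → ℝ) {u : S → ℝ} {r : ℝ} (hr : 0 ≤ r) (hu : ∀ s, |u s| ≤ r)
    (hmean : ∑ s, μ s * u s = 0) (N : ℕ) :
    ∑ x : Fin (N + 1) → S, μ₀ (x 0) * (∏ i : Fin N, P (x i.castSucc) (x i.succ)) *
        Real.exp (∑ i : Fin N, u (x i.succ)) ≤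
      ratioNorm μ₀ μ * Real.exp r * Real.exp (4 / g * r ^ 2) ^ N := by
  set T : Matrix S S ℝ := Matrix.of fun s t ↦ P s t * Real.exp (u t) with hTdef
  set w : S → ℝ := fun s ↦ μ s * Real.exp (u s) with hw
  set Λ := Real.exp (4 / g * r ^ 2)
  have hw0 : ∀ s, 0 < w s := fun s ↦ mul_pos (hμ_pos s) (Real.exp_pos _)
  have hT : ∀ s t, w s * T s t = w t * T t s := fun s t ↦ by
    simp only [hw, hTdef, Matrix.of_apply]
    linear_combination Real.exp (u s) * Real.exp (u t) * hrev s t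
  have hform : ∀ v : S → ℝ, |∑ s, w s * v s * (T *ᵥ v) s| ≤ Λ * ∑ s, w s * v s ^ 2 := by
    intro v
    have h1 : ∑ s, w s * v s * (T *ᵥ v) s = ∑ s, ∑ t, μ s * P s t *
        ((Real.exp (u s) * v s) * (Real.exp (u t) * v t)) := by
      simp only [Matrix.mulVec, dotProduct, Finset.mul_sum, hw, hTdef, Matrix.of_apply]
      exact Finset.sum_congr rfl fun s _ ↦ Finset.sum_congr rfl fun t _ ↦ by ring
    -- As `P ≥ 0`, passing to absolute values makes the one-sided Poincaré estimate control the form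
    -- from both sides, so very negative eigenvalues do no harm.
    have h2 : |∑ s, w s * v s * (T *ᵥ v) s| ≤ ∑ s, ∑ t, μ s * P s t *
        (|Real.exp (u s) * v s| * |Real.exp (u t) * v t|) := by
      rw [h1]
      refine (Finset.abs_sum_le_sum_abs _ _).trans (Finset.sum_le_sum fun s _ ↦
        (Finset.abs_sum_le_sum_abs _ _).trans (Finset.sum_le_sum fun t _ ↦ ?_))
      rw [abs_mul, abs_mul (Real.exp _ * _), abs_of_nonneg (mul_nonneg (hμ_pos s).le (hP s t))]
    refine (h2.trans (sum_mul_le_exp_mul_of_poincare hμ (fun s ↦ (hμ_pos s).le) hg hg2 hgap hr hu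
      hmean fun s ↦ |Real.exp (u s) * v s|)).trans_eq ?_
    congr 1
    refine Finset.sum_congr rfl fun s _ ↦ ?_
    rw [sq_abs, Real.exp_neg]
    have := (Real.exp_pos (u s)).ne'
    simp only [hw]
    field_simp
  set y : S → ℝ := (T ^ N) *ᵥ 1
  have hy : ∑ s, w s * y s ^ 2 ≤ (Λ ^ N) ^ 2 * Real.exp r := by
    refine (sum_mul_pow_mulVec_sq_le (sum_mul_mulVec_sq_le hT (Real.exp_pos _) hform) 1 N).trans ?_
    gcongr
    calc ∑ s, w s * (1 : S → ℝ) s ^ 2 ≤ ∑ s, μ s * Real.exp r := by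
          refine Finset.sum_le_sum fun s _ ↦ ?_
          simp only [hw, Pi.one_apply, one_pow, mul_one]
          exact mul_le_mul_of_nonneg_left (Real.exp_le_exp.2 (abs_le.1 (hu s)).2) (hμ_pos s).le
      _ = Real.exp r := by rw [← Finset.sum_mul, hμ, one_mul]
  -- Changing the weight from `μ` to `w = μ exp u` costs `e^r` here, and the norm of `1` costs
  -- another `e^r` in `hy`; after the square root one factor `e^r` remains.
  have hcs : (∑ s, μ₀ s * y s) ^ 2 ≤
      (∑ s, Real.exp r * (μ s * (μ₀ s / μ s) ^ 2)) * ∑ s, w s * y s ^ 2 := by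
    refine Finset.sum_sq_le_sum_mul_sum_of_sq_le_mul _
      (fun s _ ↦ mul_nonneg (Real.exp_pos _).le (mul_nonneg (hμ_pos s).le (sq_nonneg _)))
      (fun s _ ↦ mul_nonneg (hw0 s).le (sq_nonneg _)) fun s _ ↦ ?_
    have h1 : Real.exp r * (μ s * (μ₀ s / μ s) ^ 2) * (w s * y s ^ 2) =
        (Real.exp r * Real.exp (u s)) * (μ₀ s * y s) ^ 2 := by
      have := (hμ_pos s).ne'
      simp only [hw]
      field_simp
    rw [h1, ← Real.exp_add]
    exact le_mul_of_one_le_left (sq_nonneg _)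
      (Real.one_le_exp (by linarith [(abs_le.1 (hu s)).1]))
  have hratio : ratioNorm μ₀ μ ^ 2 = ∑ s, μ s * (μ₀ s / μ s) ^ 2 :=
    Real.sq_sqrt (Finset.sum_nonneg fun s _ ↦ mul_nonneg (hμ_pos s).le (sq_nonneg _))
  have hratio0 : 0 ≤ ratioNorm μ₀ μ := Real.sqrt_nonneg _
  have hmain : ∑ s, μ₀ s * y s ≤ ratioNorm μ₀ μ * Real.exp r * Λ ^ N := by
    refine (abs_le_of_sq_le_sq' (hcs.trans ?_) (by positivity)).2
    rw [← Finset.mul_sum, ← hratio]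
    calc _ ≤ Real.exp r * ratioNorm μ₀ μ ^ 2 * ((Λ ^ N) ^ 2 * Real.exp r) := by gcongr
      _ = _ := by ring
  refine le_of_eq_of_le ?_ hmain
  rw [← sum_trajectories_eq_pow_mulVec T N μ₀]
  refine Finset.sum_congr rfl fun x _ ↦ ?_
  simp only [hTdef, Matrix.of_apply, Finset.prod_mul_distrib, Real.exp_sum]
  ring

/-! ### Constants and conclusion -/

/-- The rate of the large deviation bound is dominated by the one obtained from the Laplace
transform. -/
lemma eight_mul_le_of_pos {g : ℝ} (hg : 0 < g) :
    8 * (4 / g + 1 / 4) ≤ 4 + 8 / g + 1536 / 125 * (g / Real.log (1 + g / 2) ^ 2) := by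
  have hlog0 : 0 < Real.log (1 + g / 2) := Real.log_pos (by linarith)
  have hlog : Real.log (1 + g / 2) ≤ g / 2 := by
    linarith [Real.log_le_sub_one_of_pos (show 0 < 1 + g / 2 by linarith)]
  -- From `log (1 + x) ≤ x`. Any constant at least `6` in place of `1536 / 125` would do for the
  -- comparison.
  have h1 : 4 / g ≤ g / Real.log (1 + g / 2) ^ 2 := by
    rw [div_le_div_iff₀ hg (by positivity)]
    nlinarith
  have h2 : 8 / g = 2 * (4 / g) := by ring
  have h3 : 0 < 4 / g := by positivity
  linarith

/-- By `(r/2 - 1)² ≥ 0`, `r ≤ 1 + r²/4`, and `e < 3`. The boundary factor `e^r` is thus traded for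
the constant `3` and an extra `1/4` in the exponent per step. -/
lemma exp_le_three_mul_exp {r : ℝ} {N : ℕ} (hN : 1 ≤ N) :
    Real.exp r ≤ 3 * Real.exp (N * (r ^ 2 / 4)) := by
  have hN' : (1 : ℝ) ≤ N := by exact_mod_cast hN
  have h1 : r ≤ 1 + N * (r ^ 2 / 4) := by nlinarith [sq_nonneg (r / 2 - 1), sq_nonneg r]
  calc Real.exp r ≤ Real.exp (1 + N * (r ^ 2 / 4)) := Real.exp_le_exp.2 h1
    _ = Real.exp 1 * Real.exp (N * (r ^ 2 / 4)) := Real.exp_add _ _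
    _ ≤ _ := by gcongr; linarith [Real.exp_one_lt_d9]

theorem corollary2
    {S : Type*} [Fintype S] [DecidableEq S] [Nontrivial S]
    {E : Type*} [NormedAddCommGroup E] [InnerProductSpace ℝ E] [FiniteDimensional ℝ E]
    {Ω : Type*} [MeasurableSpace Ω] (ℙ : Measure Ω) [IsProbabilityMeasure ℙ]
    (P : Matrix S S ℝ) (hP : P ∈ Matrix.rowStochastic ℝ S)
    (μ : S → ℝ) (hμ : μ ∈ stdSimplex ℝ S) (hμ_pos : ∀ s, 0 < μ s)
    (hrev : IsReversible P μ)
    (g : ℝ) (hg : g = spectralGap P) (hg_pos : 0 < g)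
    (μ₀ : S → ℝ) (hμ₀ : μ₀ ∈ stdSimplex ℝ S)
    (X : ℕ → Ω → S) (hX : IsMarkovChain ℙ X μ₀ P)
    (f : S → E) (hf_mean : ∑ s, μ s • f s = 0)
    (L : ℝ) (hL : 0 < L) (hf_bound : ∀ s, ‖f s‖ ≤ L)
    (ε : ℝ) (hε : 0 < ε) (N : ℕ) :
    ℙ.real {ω | ε * N ≤ ‖partialSum f X N ω‖} ≤
      3 * ratioNorm μ₀ μ * (2 : ℝ) ^ ((Module.finrank ℝ E : ℝ) / 2) *
        Real.exp (-((4 + 8 / g + 1536 / 125 * (g / Real.log (1 + g / 2) ^ 2))⁻¹ *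
          (ε ^ 2 / L ^ 2) * N)) := by
  rcases Nat.eq_zero_or_pos N with rfl | hN
  · have h1 := one_le_ratioNorm hμ₀.2 hμ.2 hμ_pos
    have h2 : (1 : ℝ) ≤ (2 : ℝ) ^ ((Module.finrank ℝ E : ℝ) / 2) :=
      Real.one_le_rpow (by norm_num) (by positivity)
    have h3 : 1 ≤ ratioNorm μ₀ μ * (2 : ℝ) ^ ((Module.finrank ℝ E : ℝ) / 2) :=
      one_le_mul_of_one_le_of_one_le h1 h2
    simp only [Nat.cast_zero, mul_zero, neg_zero, Real.exp_zero, mul_one]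
    refine measureReal_le_one.trans ?_
    linarith
  have hP0 : ∀ s t, 0 ≤ P s t := fun s t ↦ Matrix.nonneg_of_mem_rowStochastic hP
  have hgap := sum_mul_le_of_spectralGap_pos hP hμ.2 hμ_pos hrev (hg ▸ hg_pos)
  rw [← hg] at hgap
  have hg2 : g ≤ 2 := le_two_of_poincare hP hμ_pos hrev hgap
  have hNpos : (0 : ℝ) < N := by exact_mod_cast hN
  set p : (Fin (N + 1) → S) → ℝ := fun x ↦ μ₀ (x 0) * ∏ i : Fin N, P (x i.castSucc) (x i.succ)
  set z : (Fin (N + 1) → S) → E := fun x ↦ ∑ i : Fin N, f (x i.succ) with hz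
  have hp : ∀ x, 0 ≤ p x := fun x ↦
    mul_nonneg (hμ₀.1 _) (Finset.prod_nonneg fun i _ ↦ hP0 _ _)
  -- `4 / g` comes from the norm of the tilted matrix, `1 / 4` from absorbing `e^r`.
  set c := 4 / g + 1 / 4
  have hc : 0 < c := by positivity
  set a := c * N * L ^ 2
  have ha : 0 < a := by positivity
  have hratio0 : 0 ≤ ratioNorm μ₀ μ := Real.sqrt_nonneg _
  have hlaplace : ∀ θ : E, ∑ x, p x * Real.exp (inner ℝ θ (z x)) ≤
      3 * ratioNorm μ₀ μ * Real.exp (a * ‖θ‖ ^ 2) := by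
    intro θ
    have hu : ∀ s, |inner ℝ θ (f s)| ≤ ‖θ‖ * L := fun s ↦
      (abs_real_inner_le_norm _ _).trans (by gcongr; exact hf_bound s)
    have hmean : ∑ s, μ s * inner ℝ θ (f s) = 0 := by
      simp only [← real_inner_smul_right, ← inner_sum, hf_mean, inner_zero_right]
    have h1 := sum_trajectories_mul_exp_le hP0 hμ.2 hμ_pos hrev hg_pos hg2 hgap μ₀
      (by positivity) hu hmean N
    simp only [hz, inner_sum]
    refine h1.trans ?_
    calc _ ≤ ratioNorm μ₀ μ * (3 * Real.exp (N * ((‖θ‖ * L) ^ 2 / 4))) *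
          Real.exp (4 / g * (‖θ‖ * L) ^ 2) ^ N := by
          gcongr
          exact exp_le_three_mul_exp hN
      _ = 3 * ratioNorm μ₀ μ * (Real.exp (N * ((‖θ‖ * L) ^ 2 / 4)) *
          Real.exp (N * (4 / g * (‖θ‖ * L) ^ 2))) := by
          rw [Real.exp_nat_mul (4 / g * (‖θ‖ * L) ^ 2) N]
          ring
      _ = _ := by
          rw [← Real.exp_add]
          congr 2
          ring
  have hmoment := sum_mul_exp_sq_norm_le p z ha hlaplace
  have hevent : {ω | ε * N ≤ ‖partialSum f X N ω‖} =
      {ω | (fun i : Fin (N + 1) ↦ X i ω) ∈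
        Finset.univ.filter fun x ↦ ε * N ≤ ‖z x‖} := by
    ext ω
    have : partialSum f X N ω = ∑ i : Fin N, f (X (i + 1) ω) := by
      rw [partialSum, ← Finset.sum_range fun i ↦ f (X (i + 1) ω),
        Finset.range_eq_Ico, Finset.sum_Ico_add' (fun i ↦ f (X i ω)) 0 N 1]
      rfl
    simp [this, hz]
  -- Markov's inequality for `exp (‖S_N‖² / (8a))`, carried out on trajectory weights.
  have hmarkov : ℙ.real {ω | ε * N ≤ ‖partialSum f X N ω‖} ≤
      Real.exp (-((ε * N) ^ 2 / (8 * a))) * ∑ x, p x * Real.exp (‖z x‖ ^ 2 / (8 * a)) := by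
    rw [hevent]
    refine (hX.measureReal_le N _).trans ?_
    rw [Finset.sum_filter, Finset.mul_sum]
    refine Finset.sum_le_sum fun x _ ↦ ?_
    split_ifs with hx
    · rw [mul_left_comm, ← Real.exp_add]
      refine le_mul_of_one_le_right (hp x) (Real.one_le_exp ?_)
      rw [neg_add_eq_sub, sub_nonneg]
      gcongr
    · have := hp x
      positivity
  have hrate : Real.exp (-((ε * N) ^ 2 / (8 * a))) ≤
      Real.exp (-((4 + 8 / g + 1536 / 125 * (g / Real.log (1 + g / 2) ^ 2))⁻¹ *
          (ε ^ 2 / L ^ 2) * N)) := by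
    have h1 : (ε * N) ^ 2 / (8 * a) = (8 * c)⁻¹ * (ε ^ 2 / L ^ 2) * N := by
      simp only [a]
      field_simp
    rw [h1]
    gcongr
    exact eight_mul_le_of_pos hg_pos
  calc _ ≤ _ := hmarkov
    _ ≤ Real.exp (-((ε * N) ^ 2 / (8 * a))) *
        (3 * ratioNorm μ₀ μ * (2 : ℝ) ^ ((Module.finrank ℝ E : ℝ) / 2)) := by gcongr
    _ ≤ _ := by
      rw [mul_comm]
      gcongr
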